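/- For graphs on the vertex set $\{1,\dots,n\}$, let $\textsc{Connected}_n$ be the two-party communication problem in which Alice receives a set $E_A$ and Bob a set $E_B$ of edges (unordered pairs of distinct vertices; the sets may overlap), and the goal is to decide whether the graph $(\{1,\dots,n\},E_A\cup E_B)$ is connected. Let $D(f)$ be the deterministic communication complexity of $f$: the least depth of a protocol tree computing $f$, in which one party sends one bit at every inner node. Let $Q_2(f)$ be the least number of qubits sent by a quantum protocol that computes $f$ with error probability at most $1/3$ on every input; in such a protocol each party holds finitely many qubits, all initially in state $|0\rangle$, and in each step a party fixed by the protocol applies to its own qubits a unitary depending on its own input and sends one qubit to the other party; at the end one party, fixed by the protocol, applies such a unitary and measures one of its qubits to get the output. Let $Q_2^*(f)$ be the same quantity when the protocol may start in any joint state of the two parties' (finitely many, but arbitrarily many) qubits that does not depend on the input (unlimited prior entanglement). Then $$\Omega(n)\le Q_2(\textsc{Connected}_n)\le D(\textsc{Connected}_n)\le O(n\log n),$$ where the middle inequality holds for every $n$. The lower bound also holds with prior entanglement, $Q_2^*(\textsc{Connected}_n)\ge\Omega(n)$. It even holds for disjoint edge sets and sparse graphs: there are constants $c>0$ and $K$ such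 that, for all sufficiently large $n$, every protocol with prior entanglement that is required to have error probability at most $1/3$ only on inputs with $E_A\cap E_B=\emptyset$ and $|E_A\cup E_B|\le Kn$ sends at least $cn$ qubits. -/

import Mathlib

open Filter
open scoped ENNReal

/-! ### Deterministic communication complexity -/

/-- A deterministic two-party protocol tree, Alice holding `x : X` and Bob holding `y : Y`. At an
inner node one party sends one bit, a function of its own input; the bit selects the subtree with
which the protocol continues (so the next speaker may depend on the transcript). A leaf is labelled
with the output. -/
inductive DetProtocol (X Y : Type) : Type
  | leaf (out : Bool) : DetProtocol X Y
  | aliceSends (bit : X → Bool) (next : Bool → DetProtocol X Y) : DetProtocol X Y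
  | bobSends (bit : Y → Bool) (next : Bool → DetProtocol X Y) : DetProtocol X Y

namespace DetProtocol

variable {X Y : Type}

/-- The output of the protocol on input `(x, y)`. -/
def output : DetProtocol X Y → X → Y → Bool
  | leaf out, _, _ => out
  | aliceSends bit next, x, y => (next (bit x)).output x y
  | bobSends bit next, x, y => (next (bit y)).output x y

/-- The worst-case number of bits sent: the depth of the tree. -/
def cost : DetProtocol X Y → ℕ
  | leaf _ => 0
  | aliceSends _ next => 1 + max (next false).cost (next true).cost
  | bobSends _ next => 1 + max (next false).cost (next true).cost

end DetProtocol

/-- The deterministic communication complexity `D(f)`. -/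
noncomputable def detCC {X Y : Type} (f : X → Y → Prop) : ℕ∞ :=
  ⨅ (P : DetProtocol X Y) (_ : ∀ x y, P.output x y = true ↔ f x y), (P.cost : ℕ∞)

/-! ### Quantum communication complexity -/

/-- Labels of the computational basis of a register of `k` qubits. -/
abbrev Qubits (k : ℕ) : Type := Fin k → Bool

/-- A joint pure state (vector of amplitudes) of Alice's `p` qubits and Bob's `q` qubits: the entry
`ψ a b` is the amplitude of `|a⟩ ⊗ |b⟩`. -/
abbrev JointState (p q : ℕ) : Type := Matrix (Qubits p) (Qubits q) ℂ

namespace JointState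

variable {p q : ℕ}

/-- The squared Euclidean norm of the vector of amplitudes. -/
noncomputable def normSq (ψ : JointState p q) : ℝ := ∑ a, ∑ b, ‖ψ a b‖ ^ 2

/-- The state `|0…0⟩ ⊗ |0…0⟩`. -/
def zeroState (p q : ℕ) : JointState p q :=
  fun a b => if a = (fun _ => false) ∧ b = (fun _ => false) then 1 else 0

/-- The state `(U ⊗ I) ψ`. -/
noncomputable def actAlice (U : Matrix.unitaryGroup (Qubits p) ℂ) (ψ : JointState p q) :
    JointState p q :=
  fun a b => ∑ a', (U : Matrix (Qubits p) (Qubits p) ℂ) a a' * ψ a' b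

/-- The state `(I ⊗ V) ψ`. -/
noncomputable def actBob (V : Matrix.unitaryGroup (Qubits q) ℂ) (ψ : JointState p q) :
    JointState p q :=
  fun a b => ∑ b', (V : Matrix (Qubits q) (Qubits q) ℂ) b b' * ψ a b'

/-- Alice's first qubit is handed over to Bob and becomes his first qubit. -/
def moveToBob (ψ : JointState (p + 1) q) : JointState p (q + 1) :=
  fun a b => ψ (Fin.cons (b 0) a) (Fin.tail b)

/-- Bob's first qubit is handed over to Alice and becomes her first qubit. -/
def moveToAlice (ψ : JointState p (q + 1)) : JointState (p + 1) q :=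
  fun a b => ψ (Fin.tail a) (Fin.cons (a 0) b)

/-- The probability that measuring Alice's first qubit in the computational basis gives `1`. -/
noncomputable def probAliceOne (ψ : JointState (p + 1) q) : ℝ :=
  ∑ a, ∑ b, if a 0 = true then ‖ψ a b‖ ^ 2 else 0

/-- The probability that measuring Bob's first qubit in the computational basis gives `1`. -/
noncomputable def probBobOne (ψ : JointState p (q + 1)) : ℝ :=
  ∑ a, ∑ b, if b 0 = true then ‖ψ a b‖ ^ 2 else 0

end JointState

/-- A two-party quantum protocol in the qubit model, started when Alice holds `p` and Bob holds `q`
qubits. In each step one party, fixed by the protocol, applies a unitary that depends on its own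
input to the qubits that it holds and sends one qubit to the other party. At the end one party
applies such a unitary and measures its first qubit to obtain the output. Private randomness and
intermediate measurements are covered by extra workspace qubits (`p` and `q` are arbitrary). -/
inductive QuantumProtocol (X Y : Type) : ℕ → ℕ → Type
  | aliceOutputs {p q : ℕ} (U : X → Matrix.unitaryGroup (Qubits (p + 1)) ℂ) :
      QuantumProtocol X Y (p + 1) q
  | bobOutputs {p q : ℕ} (V : Y → Matrix.unitaryGroup (Qubits (q + 1)) ℂ) :
      QuantumProtocol X Y p (q + 1)
  | aliceSends {p q : ℕ} (U : X → Matrix.unitaryGroup (Qubits (p + 1)) ℂ)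
      (next : QuantumProtocol X Y p (q + 1)) : QuantumProtocol X Y (p + 1) q
  | bobSends {p q : ℕ} (V : Y → Matrix.unitaryGroup (Qubits (q + 1)) ℂ)
      (next : QuantumProtocol X Y (p + 1) q) : QuantumProtocol X Y p (q + 1)

namespace QuantumProtocol

variable {X Y : Type}

/-- The number of qubits sent. -/
def cost : {p q : ℕ} → QuantumProtocol X Y p q → ℕ
  | _, _, aliceOutputs _ => 0
  | _, _, bobOutputs _ => 0
  | _, _, aliceSends _ next => next.cost + 1
  | _, _, bobSends _ next => next.cost + 1

/-- The probability that the protocol outputs `1` on input `(x, y)` when started in state `ψ`. -/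
noncomputable def probOne (x : X) (y : Y) :
    {p q : ℕ} → QuantumProtocol X Y p q → JointState p q → ℝ
  | _, _, aliceOutputs U, ψ => (ψ.actAlice (U x)).probAliceOne
  | _, _, bobOutputs V, ψ => (ψ.actBob (V y)).probBobOne
  | _, _, aliceSends U next, ψ => next.probOne x y (ψ.actAlice (U x)).moveToBob
  | _, _, bobSends V next, ψ => next.probOne x y (ψ.actBob (V y)).moveToAlice

/-- Started in state `ψ`, the protocol computes `f` with error probability at most `1/3` on every
input that satisfies the promise `S`. -/
def Computes {p q : ℕ} (P : QuantumProtocol X Y p q) (ψ : JointState p q)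
    (S f : X → Y → Prop) : Prop :=
  ∀ x y, S x y →
    (f x y → 2 / 3 ≤ P.probOne x y ψ) ∧ (¬ f x y → P.probOne x y ψ ≤ 1 / 3)

end QuantumProtocol

/-- The bounded-error quantum communication complexity `Q₂` of `f` under the promise `S`, without
prior entanglement: all qubits start in state `|0⟩`. -/
noncomputable def quantumCC {X Y : Type} (S f : X → Y → Prop) : ℕ∞ :=
  ⨅ (p : ℕ) (q : ℕ) (P : QuantumProtocol X Y p q)
    (_ : P.Computes (JointState.zeroState p q) S f), (P.cost : ℕ∞)

/-- The bounded-error quantum communication complexity of `f` under the promise `S` with unlimited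
prior entanglement: the protocol starts in an arbitrary joint state independent of the input. -/
noncomputable def entangledQuantumCC {X Y : Type} (S f : X → Y → Prop) : ℕ∞ :=
  ⨅ (p : ℕ) (q : ℕ) (ψ : JointState p q) (_ : ψ.normSq = 1) (P : QuantumProtocol X Y p q)
    (_ : P.Computes ψ S f), (P.cost : ℕ∞)

/-! ### The graph problem -/

/-- The problem `Connected_n`: Alice and Bob hold edge sets `E_A` and `E_B` on the vertex set
`{1, …, n}`, given as simple graphs, and the question is whether `E_A ∪ E_B` is connected. -/
def ConnectedProblem (n : ℕ) (EA EB : SimpleGraph (Fin n)) : Prop := (EA ⊔ EB).Connected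

/-- The trivial promise: all pairs of inputs are allowed. -/
def noPromise {X Y : Type} (_ : X) (_ : Y) : Prop := True

/-- The promise that `E_A` and `E_B` are disjoint and that `E_A ∪ E_B` has at most `K * n` edges. -/
def disjointSparse (K n : ℕ) (EA EB : SimpleGraph (Fin n)) : Prop :=
  Disjoint EA.edgeSet EB.edgeSet ∧ (EA ⊔ EB).edgeSet.ncard ≤ K * n

/-! Lower bound. Each qubit sent doubles the number of terms in an expansion of the joint state into
summands `A x * ψ * B y` with contractions `A x` and `B y`. The acceptance probability is quadratic
in the state, so after `c` qubits it is a sum of `4 ^ c` inner products of a vector depending on `x`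
with a vector depending on `y`, both of norm at most 1
(`QuantumProtocol.hasTraceExpansion_probOne`). The dimension of `ψ` plays no role, which is why
prior entanglement does not help. Such an inner product correlates with a matrix `H` by at most `‖H‖
* √(|X| |Y|)`. As the Hadamard matrix has norm at most `2 ^ (N / 2)`, the inner product modulo two
of `N`-bit strings costs at least `N / 4 - O(1)` qubits.

Inner product reduces to connectivity on a graph of width four. Four tracks run through `4 * N`
steps, in which Alice and Bob alternately permute them; for every index the four steps form a
commutator, which shifts the tracks by two exactly when both bits are 1. The parity thus decides
where one track starts, and a closing edge turns this into connectivity (`connected_gadget_iff`).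
There are `O(N)` vertices, and each accounts for at most one edge, so the instances are sparse.

Upper bounds. Everything is governed by the number `B` of partitions of the vertex set. Alice names
the partition into components of her graph with `⌈log₂ B⌉` bits or qubits, and Bob decides; `B ≤ n ^
n` gives `O(n log n)`. The inequality between `Q₂` and `D` is exact because the communication matrix
contains the nonsingular matrix `[r ⊔ s = ⊤]` of order `B`, so that `2 ^ D ≥ B`
(`card_setoid_le_two_pow_cost`). This avoids simulating trees with adaptive speakers by protocols
with a fixed order of speakers. -/

section LocalExpansion

open Matrix
open scoped Matrix.Norms.L2Operator

/-! ### Frobenius norms, contractions and the transfer of a qubit. -/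

section Frobenius

variable {m n k : Type*} [Fintype m] [Fintype n] [Fintype k]

/-- The squared Frobenius norm. -/
noncomputable def frobSq (A : Matrix m n ℂ) : ℝ := ∑ i, ∑ j, ‖A i j‖ ^ 2

lemma frobSq_nonneg (A : Matrix m n ℂ) : 0 ≤ frobSq A := by
  unfold frobSq; positivity

lemma frobSq_conjTranspose (A : Matrix m n ℂ) : frobSq Aᴴ = frobSq A := by
  simp only [frobSq, conjTranspose_apply, norm_star]
  exact Finset.sum_comm

lemma frobSq_mul_le [DecidableEq n] (A : Matrix m n ℂ) (B : Matrix n k ℂ) :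
    frobSq (A * B) ≤ ‖A‖ ^ 2 * frobSq B := by
  have key : ∀ j, ∑ i, ‖(A * B) i j‖ ^ 2 ≤ ‖A‖ ^ 2 * ∑ i, ‖B i j‖ ^ 2 := by
    intro j
    have h := l2_opNorm_mulVec A (WithLp.toLp 2 (fun i => B i j))
    have h2 := pow_le_pow_left₀ (norm_nonneg _) h 2
    rw [mul_pow, EuclideanSpace.norm_sq_eq, EuclideanSpace.norm_sq_eq] at h2
    exact h2
  unfold frobSq
  rw [Finset.sum_comm, Finset.sum_comm (f := fun i j => ‖B i j‖ ^ 2), Finset.mul_sum]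
  exact Finset.sum_le_sum fun j _ => key j

lemma norm_sum_mul_le (A B : Matrix m n ℂ) :
    ‖∑ i, ∑ j, A i j * B i j‖ ≤ √(frobSq A) * √(frobSq B) := by
  unfold frobSq
  simp only [← Fintype.sum_prod_type']
  calc _ ≤ ∑ z : m × n, ‖A z.1 z.2‖ * ‖B z.1 z.2‖ :=
        (norm_sum_le _ _).trans (le_of_eq (by simp only [norm_mul]))
    _ ≤ _ := Real.sum_mul_le_sqrt_mul_sqrt _ _ _

end Frobenius

/-- Cauchy–Schwarz for the Frobenius pairing of `u` with `H * v`, where `H` scales Frobenius norms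
by at most `‖H‖`. The size of `I` does not enter. -/
lemma norm_sum_mul_bilinear_le {X Y I : Type*} [Fintype X] [Fintype Y] [Fintype I]
    [DecidableEq X] [DecidableEq Y] [DecidableEq I]
    (H : Matrix X Y ℂ) (u : X → I → ℂ) (v : Y → I → ℂ)
    (hu : ∀ x, ∑ i, ‖u x i‖ ^ 2 ≤ 1) (hv : ∀ y, ∑ i, ‖v y i‖ ^ 2 ≤ 1) :
    ‖∑ x, ∑ y, H x y * ∑ i, u x i * v y i‖ ≤
      ‖H‖ * (√(Fintype.card X) * √(Fintype.card Y)) := by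
  have e : ∑ x, ∑ y, H x y * ∑ i, u x i * v y i =
      ∑ x, ∑ i, (of u : Matrix X I ℂ) x i * (H * (of v : Matrix Y I ℂ)) x i := by
    refine Finset.sum_congr rfl fun x _ => ?_
    simp only [mul_apply, Finset.mul_sum, of_apply]
    rw [Finset.sum_comm]
    exact Finset.sum_congr rfl fun _ _ => Finset.sum_congr rfl fun _ _ => by ring
  have hU : frobSq (of u : Matrix X I ℂ) ≤ Fintype.card X := by
    refine (Finset.sum_le_sum fun x _ => hu x).trans (by simp)
  have hV : frobSq (of v : Matrix Y I ℂ) ≤ Fintype.card Y := by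
    refine (Finset.sum_le_sum fun x _ => hv x).trans (by simp)
  rw [e]
  refine (norm_sum_mul_le _ _).trans ?_
  have h1 : √(frobSq (H * (of v : Matrix Y I ℂ))) ≤ ‖H‖ * √(Fintype.card Y) := by
    rw [← Real.sqrt_sq (norm_nonneg H), ← Real.sqrt_mul (by positivity)]
    exact Real.sqrt_le_sqrt ((frobSq_mul_le _ _).trans (by gcongr))
  calc _ ≤ √(Fintype.card X) * (‖H‖ * √(Fintype.card Y)) :=
        mul_le_mul (Real.sqrt_le_sqrt hU) h1 (by positivity) (by positivity)
    _ = _ := by ring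

lemma norm_mul_le_one {m n k : Type*} [Fintype m] [Fintype n] [Fintype k]
    [DecidableEq m] [DecidableEq n] [DecidableEq k] {A : Matrix m n ℂ} {B : Matrix n k ℂ}
    (hA : ‖A‖ ≤ 1) (hB : ‖B‖ ≤ 1) : ‖A * B‖ ≤ 1 :=
  (l2_opNorm_mul A B).trans (mul_le_one₀ hA (norm_nonneg _) hB)

lemma norm_one_le_one {n : Type*} [Fintype n] [DecidableEq n] : ‖(1 : Matrix n n ℂ)‖ ≤ 1 := by
  rw [← diagonal_one, l2_opNorm_diagonal]
  exact (pi_norm_le_iff_of_nonneg zero_le_one).2 fun i => by simp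

lemma norm_le_one_of_conjTranspose_mul_self {m n : Type*} [Fintype m] [Fintype n] [DecidableEq m]
    [DecidableEq n] {A : Matrix m n ℂ} (h : Aᴴ * A = 1) : ‖A‖ ≤ 1 := by
  have h1 := l2_opNorm_conjTranspose_mul_self A
  rw [h] at h1
  have h2 : ‖(1 : Matrix n n ℂ)‖ ≤ 1 := norm_one_le_one
  nlinarith [norm_nonneg A]

lemma norm_conjTranspose_le_one {m n : Type*} [Fintype m] [Fintype n] [DecidableEq m]
    [DecidableEq n] {A : Matrix m n ℂ} (h : ‖A‖ ≤ 1) : ‖Aᴴ‖ ≤ 1 :=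
  (l2_opNorm_conjTranspose A).trans_le h

lemma norm_unitary_le_one {n : Type*} [Fintype n] [DecidableEq n] (U : unitaryGroup n ℂ) :
    ‖(U : Matrix n n ℂ)‖ ≤ 1 :=
  norm_le_one_of_conjTranspose_mul_self (mem_unitaryGroup_iff'.1 U.2)

lemma norm_transpose_unitary_le_one {n : Type*} [Fintype n] [DecidableEq n]
    (U : unitaryGroup n ℂ) : ‖(U : Matrix n n ℂ)ᵀ‖ ≤ 1 := by
  refine norm_le_one_of_conjTranspose_mul_self ?_
  have := mem_unitaryGroup_iff.1 U.2
  rw [star_eq_conjTranspose] at this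
  rw [show ((U : Matrix n n ℂ)ᵀ)ᴴ = ((U : Matrix n n ℂ)ᴴ)ᵀ from rfl, ← transpose_mul, this,
    transpose_one]

/-- Projecting away the first qubit onto the basis vector `β`. -/
noncomputable def cutQubit (p : ℕ) (β : Bool) : Matrix (Qubits p) (Qubits (p + 1)) ℂ :=
  fun a a' => if a' = Fin.cons β a then 1 else 0

lemma cutQubit_mul_conjTranspose (p : ℕ) (β : Bool) :
    cutQubit p β * (cutQubit p β)ᴴ = 1 := by
  ext a b
  simp [mul_apply, cutQubit, one_apply, eq_comm, Fin.cons_inj]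

lemma norm_cutQubit_le_one (p : ℕ) (β : Bool) : ‖cutQubit p β‖ ≤ 1 := by
  rw [← l2_opNorm_conjTranspose]
  refine norm_le_one_of_conjTranspose_mul_self ?_
  rw [conjTranspose_conjTranspose, cutQubit_mul_conjTranspose]

/-- A resolution of the identity on the moved qubit: each basis value is projected out on one side
and attached on the other. Transfers are the only source of new terms. -/
lemma moveToBob_eq {p q : ℕ} (ψ : Matrix (Qubits (p + 1)) (Qubits q) ℂ) :
    JointState.moveToBob ψ =
      ∑ β, (cutQubit p β * ψ * cutQubit q β : Matrix (Qubits p) (Qubits (q + 1)) ℂ) := by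
  ext a b
  have hb : ∀ (β : Bool) (c : Qubits q), b = Fin.cons β c ↔ (β = b 0 ∧ c = Fin.tail b) := by
    intro β c
    conv_lhs => rw [← Fin.cons_self_tail b, Fin.cons_inj]
    tauto
  simp only [JointState.moveToBob, Matrix.sum_apply, mul_apply, cutQubit, hb]
  simp [ite_and]

lemma moveToAlice_eq {p q : ℕ} (ψ : Matrix (Qubits p) (Qubits (q + 1)) ℂ) :
    JointState.moveToAlice ψ =
      ∑ β, ((cutQubit p β)ᴴ * ψ * (cutQubit q β)ᴴ : Matrix (Qubits (p + 1)) (Qubits q) ℂ) := by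
  ext a b
  have hb : ∀ (β : Bool) (c : Qubits p), a = Fin.cons β c ↔ (β = a 0 ∧ c = Fin.tail a) := by
    intro β c
    conv_lhs => rw [← Fin.cons_self_tail a, Fin.cons_inj]
    tauto
  simp only [JointState.moveToAlice, Matrix.sum_apply, mul_apply, conjTranspose_apply, cutQubit, hb]
  simp [ite_and, apply_ite (starRingEnd ℂ)]

/-- `Ψ x y` is a sum of `N` terms `A x * ψ * B y` with contractions `A x` and `B y`. -/
def HasLocalExpansion {X Y m₀ n₀ m n : Type} [Fintype m₀] [Fintype n₀] [Fintype m] [Fintype n]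
    [DecidableEq m₀] [DecidableEq n₀] [DecidableEq m] [DecidableEq n]
    (ψ : Matrix m₀ n₀ ℂ) (N : ℕ) (Ψ : X → Y → Matrix m n ℂ) : Prop :=
  ∃ (T : Type) (_ : Fintype T) (A : T → X → Matrix m m₀ ℂ) (B : T → Y → Matrix n₀ n ℂ),
    Fintype.card T = N ∧ (∀ t x, ‖A t x‖ ≤ 1) ∧ (∀ t y, ‖B t y‖ ≤ 1) ∧
    ∀ x y, Ψ x y = ∑ t, A t x * ψ * B t y

/-- `p x y` is a sum of `N` terms `tr (ψᴴ * M x * ψ * N y)` with contractions `M x` and `N y`. -/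
def HasTraceExpansion {X Y m₀ n₀ : Type} [Fintype m₀] [Fintype n₀]
    [DecidableEq m₀] [DecidableEq n₀]
    (ψ : Matrix m₀ n₀ ℂ) (N : ℕ) (p : X → Y → ℂ) : Prop :=
  ∃ (T : Type) (_ : Fintype T) (A : T → X → Matrix m₀ m₀ ℂ) (B : T → Y → Matrix n₀ n₀ ℂ),
    Fintype.card T = N ∧ (∀ t x, ‖A t x‖ ≤ 1) ∧ (∀ t y, ‖B t y‖ ≤ 1) ∧
    ∀ x y, p x y = ∑ t, (ψᴴ * A t x * ψ * B t y).trace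

/-! ### Expansions into local contractions. -/

section Expansion

variable {X Y m₀ n₀ m n m' n' : Type} [Fintype m₀] [Fintype n₀] [Fintype m] [Fintype n]
  [Fintype m'] [Fintype n'] [DecidableEq m'] [DecidableEq n']
  [DecidableEq m₀] [DecidableEq n₀] [DecidableEq m] [DecidableEq n]
  {ψ : Matrix m₀ n₀ ℂ} {N : ℕ} {Ψ : X → Y → Matrix m n ℂ}

lemma HasLocalExpansion.congr (h : HasLocalExpansion ψ N Ψ) {Ψ' : X → Y → Matrix m n ℂ}
    (e : ∀ x y, Ψ' x y = Ψ x y) : HasLocalExpansion ψ N Ψ' := by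
  rwa [show Ψ' = Ψ from funext₂ e]

lemma HasTraceExpansion.congr {p p' : X → Y → ℂ} (h : HasTraceExpansion ψ N p)
    (e : ∀ x y, p' x y = p x y) : HasTraceExpansion ψ N p' := by
  rwa [show p' = p from funext₂ e]

lemma HasLocalExpansion.sum_mul (h : HasLocalExpansion ψ N Ψ) {ι : Type} [Fintype ι]
    (E : ι → X → Matrix m' m ℂ) (F : ι → Y → Matrix n n' ℂ)
    (hE : ∀ i x, ‖E i x‖ ≤ 1) (hF : ∀ i y, ‖F i y‖ ≤ 1) :
    HasLocalExpansion ψ (Fintype.card ι * N) fun x y => ∑ i, E i x * Ψ x y * F i y := by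
  obtain ⟨T, _, A, B, hT, hA, hB, hΨ⟩ := h
  refine ⟨ι × T, inferInstance, fun t x => E t.1 x * A t.2 x, fun t y => B t.2 y * F t.1 y,
    by simp [hT], fun t x => norm_mul_le_one (hE _ _) (hA _ _),
    fun t x => norm_mul_le_one (hB _ _) (hF _ _), fun x y => ?_⟩
  simp only [hΨ, Fintype.sum_prod_type, Matrix.mul_sum, Matrix.sum_mul, Matrix.mul_assoc]

/-- Both copies of `Ψ` are expanded, which squares the number of terms; cyclicity of the trace
gathers Bob's factors. -/
lemma HasLocalExpansion.trace (h : HasLocalExpansion ψ N Ψ)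
    (E : X → Matrix m m ℂ) (F : Y → Matrix n n ℂ)
    (hE : ∀ x, ‖E x‖ ≤ 1) (hF : ∀ y, ‖F y‖ ≤ 1) :
    HasTraceExpansion ψ (N * N) fun x y => ((Ψ x y)ᴴ * E x * Ψ x y * F y).trace := by
  obtain ⟨T, _, A, B, hT, hA, hB, hΨ⟩ := h
  refine ⟨T × T, inferInstance, fun t x => (A t.1 x)ᴴ * E x * A t.2 x,
    fun t y => B t.2 y * F y * (B t.1 y)ᴴ, by simp [hT],
    fun t x => norm_mul_le_one (norm_mul_le_one (norm_conjTranspose_le_one (hA _ _)) (hE _)) (hA _ _),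
    fun t x => norm_mul_le_one (norm_mul_le_one (hB _ _) (hF _)) (norm_conjTranspose_le_one (hB _ _)),
    fun x y => ?_⟩
  simp only [hΨ, conjTranspose_sum, conjTranspose_mul, Fintype.sum_prod_type, Matrix.mul_sum,
    Matrix.sum_mul, trace_sum]
  rw [Finset.sum_comm]
  refine Finset.sum_congr rfl fun s _ => Finset.sum_congr rfl fun t _ => ?_
  simp only [Matrix.mul_assoc]
  rw [trace_mul_comm]
  simp only [Matrix.mul_assoc]

/-- Each trace pairs the entries of `ψᴴ * A t x` with those of `ψ * B t y`. One copy of `ψ` goes to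
each side, so both vectors have norm at most 1 whatever the dimension. -/
lemma HasTraceExpansion.norm_sum_le [Fintype X] [Fintype Y] [DecidableEq X] [DecidableEq Y]
    {p : X → Y → ℂ} (h : HasTraceExpansion ψ N p) (hψ : frobSq ψ ≤ 1) (H : Matrix X Y ℂ) :
    ‖∑ x, ∑ y, H x y * p x y‖ ≤ N * (‖H‖ * (√(Fintype.card X) * √(Fintype.card Y))) := by
  obtain ⟨T, _, A, B, hT, hA, hB, hp⟩ := h
  have e : ∑ x, ∑ y, H x y * p x y =
      ∑ t, ∑ x, ∑ y, H x y * (ψᴴ * A t x * ψ * B t y).trace := by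
    simp only [hp, Finset.mul_sum]
    rw [Finset.sum_comm]
    refine (Finset.sum_congr rfl fun _ _ => Finset.sum_comm).trans ?_
    rw [Finset.sum_comm]
    exact Finset.sum_congr rfl fun _ _ => Finset.sum_comm
  rw [e, ← hT, ← nsmul_eq_mul]
  refine (norm_sum_le_of_le Finset.univ fun t _ => ?_).trans_eq
    (by rw [Finset.sum_const, Finset.card_univ])
  have := norm_sum_mul_bilinear_le H
    (fun x (i : n₀ × m₀) => (ψᴴ * A t x) i.1 i.2) (fun y i => (ψ * B t y) i.2 i.1)
    (fun x => ?_) (fun y => ?_)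
  · have htr : ∀ x y, (ψᴴ * A t x * ψ * B t y).trace =
        ∑ i : n₀ × m₀, (ψᴴ * A t x) i.1 i.2 * (ψ * B t y) i.2 i.1 := by
      intro x y
      rw [Matrix.mul_assoc (ψᴴ * A t x)]
      simp only [Matrix.trace, diag_apply, mul_apply (M := ψᴴ * A t x), Fintype.sum_prod_type]
    simpa only [htr] using this
  · rw [Fintype.sum_prod_type]
    change frobSq (ψᴴ * A t x) ≤ 1
    rw [← frobSq_conjTranspose, conjTranspose_mul, conjTranspose_conjTranspose]
    refine (frobSq_mul_le _ _).trans (mul_le_one₀ (pow_le_one₀ (norm_nonneg _)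
      (norm_conjTranspose_le_one (hA _ _))) (frobSq_nonneg _) hψ)
  · rw [Fintype.sum_prod_type]
    rw [Finset.sum_comm]
    change frobSq (ψ * B t y) ≤ 1
    rw [← frobSq_conjTranspose, conjTranspose_mul]
    refine (frobSq_mul_le _ _).trans (mul_le_one₀ (pow_le_one₀ (norm_nonneg _)
      (norm_conjTranspose_le_one (hB _ _))) (frobSq_nonneg _) (by rwa [frobSq_conjTranspose]))

end Expansion

/-- The projection onto the states whose first qubit is `1`. -/
noncomputable def firstQubitOne (p : ℕ) : Matrix (Qubits (p + 1)) (Qubits (p + 1)) ℂ :=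
  diagonal fun a => if a 0 = true then 1 else 0

lemma norm_firstQubitOne_le_one (p : ℕ) : ‖firstQubitOne p‖ ≤ 1 := by
  rw [firstQubitOne, l2_opNorm_diagonal]
  refine (pi_norm_le_iff_of_nonneg zero_le_one).2 fun i => ?_
  split_ifs <;> simp

lemma probAliceOne_eq_trace {p q : ℕ} (ψ : Matrix (Qubits (p + 1)) (Qubits q) ℂ) :
    ((JointState.probAliceOne ψ : ℝ) : ℂ) = (ψᴴ * firstQubitOne p * ψ).trace := by
  simp only [JointState.probAliceOne, firstQubitOne, Matrix.trace, diag_apply,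
    mul_apply (N := ψ), mul_diagonal, conjTranspose_apply]
  push_cast
  rw [Finset.sum_comm]
  refine Finset.sum_congr rfl fun b _ => Finset.sum_congr rfl fun a _ => ?_
  split_ifs
  · simp [← Complex.conj_mul']
  · simp

lemma probBobOne_eq_trace {p q : ℕ} (ψ : Matrix (Qubits p) (Qubits (q + 1)) ℂ) :
    ((JointState.probBobOne ψ : ℝ) : ℂ) = (ψᴴ * ψ * firstQubitOne q).trace := by
  simp only [JointState.probBobOne, firstQubitOne, Matrix.trace, diag_apply,
    mul_diagonal]
  push_cast
  rw [Finset.sum_comm]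
  refine Finset.sum_congr rfl fun b _ => ?_
  rw [mul_apply, Finset.sum_mul]
  refine Finset.sum_congr rfl fun a _ => ?_
  split_ifs
  · simp [← Complex.conj_mul']
  · simp

lemma actAlice_eq_mul {p q : ℕ} (U : unitaryGroup (Qubits p) ℂ) (ψ : Matrix (Qubits p) (Qubits q) ℂ) :
    JointState.actAlice U ψ = (U : Matrix (Qubits p) (Qubits p) ℂ) * ψ := rfl

lemma actBob_eq_mul {p q : ℕ} (V : unitaryGroup (Qubits q) ℂ) (ψ : Matrix (Qubits p) (Qubits q) ℂ) :
    JointState.actBob V ψ = ψ * (V : Matrix (Qubits q) (Qubits q) ℂ)ᵀ := by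
  ext a b
  simp [JointState.actBob, mul_apply, mul_comm]

/-! ### Expansions along a quantum protocol. -/

section Steps

variable {X Y m₀ n₀ : Type} [Fintype m₀] [Fintype n₀] [DecidableEq m₀] [DecidableEq n₀]
  {ψ : Matrix m₀ n₀ ℂ} {N p q : ℕ}

lemma HasLocalExpansion.probAliceOne {Ψ : X → Y → Matrix (Qubits (p + 1)) (Qubits q) ℂ}
    (h : HasLocalExpansion ψ N Ψ) (U : X → unitaryGroup (Qubits (p + 1)) ℂ) :
    HasTraceExpansion ψ (N * N) fun x y =>
      ((JointState.probAliceOne (JointState.actAlice (U x) (Ψ x y)) : ℝ) : ℂ) := by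
  have hE : ∀ x, ‖(U x : Matrix (Qubits (p + 1)) (Qubits (p + 1)) ℂ)ᴴ * firstQubitOne p *
      (U x : Matrix (Qubits (p + 1)) (Qubits (p + 1)) ℂ)‖ ≤ 1 := fun x =>
    norm_mul_le_one (norm_mul_le_one (norm_conjTranspose_le_one (norm_unitary_le_one (U x)))
        (norm_firstQubitOne_le_one p)) (norm_unitary_le_one (U x))
  refine (h.trace _ (fun _ => 1) hE (fun _ => norm_one_le_one)).congr fun x y => ?_
  rw [actAlice_eq_mul, probAliceOne_eq_trace, conjTranspose_mul]
  simp only [Matrix.mul_assoc, Matrix.mul_one]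

lemma HasLocalExpansion.probBobOne {Ψ : X → Y → Matrix (Qubits p) (Qubits (q + 1)) ℂ}
    (h : HasLocalExpansion ψ N Ψ) (V : Y → unitaryGroup (Qubits (q + 1)) ℂ) :
    HasTraceExpansion ψ (N * N) fun x y =>
      ((JointState.probBobOne (JointState.actBob (V y) (Ψ x y)) : ℝ) : ℂ) := by
  have hF : ∀ y, ‖(V y : Matrix (Qubits (q + 1)) (Qubits (q + 1)) ℂ)ᵀ * firstQubitOne q *
      ((V y : Matrix (Qubits (q + 1)) (Qubits (q + 1)) ℂ)ᵀ)ᴴ‖ ≤ 1 := fun y =>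
    norm_mul_le_one (norm_mul_le_one (norm_transpose_unitary_le_one (V y))
      (norm_firstQubitOne_le_one q))
      (norm_conjTranspose_le_one (norm_transpose_unitary_le_one (V y)))
  refine (h.trace (fun _ => 1) _ (fun _ => norm_one_le_one) hF).congr fun x y => ?_
  rw [actBob_eq_mul, probBobOne_eq_trace, conjTranspose_mul, Matrix.mul_assoc,
    Matrix.mul_assoc, trace_mul_comm]
  simp only [Matrix.mul_assoc, Matrix.mul_one]

lemma HasLocalExpansion.moveToBob {Ψ : X → Y → Matrix (Qubits (p + 1)) (Qubits q) ℂ}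
    (h : HasLocalExpansion ψ N Ψ) (U : X → unitaryGroup (Qubits (p + 1)) ℂ) :
    HasLocalExpansion (m := Qubits p) (n := Qubits (q + 1)) ψ (2 * N) fun x y =>
      JointState.moveToBob (JointState.actAlice (U x) (Ψ x y)) := by
  have hE : ∀ (β : Bool) x, ‖cutQubit p β * (U x : Matrix (Qubits (p + 1)) (Qubits (p + 1)) ℂ)‖ ≤ 1 :=
    fun β x => norm_mul_le_one (norm_cutQubit_le_one _ β) (norm_unitary_le_one (U x))
  refine (h.sum_mul _ (fun β _ => cutQubit q β) hE
    (fun β x => norm_cutQubit_le_one _ β)).congr fun x y => ?_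
  rw [actAlice_eq_mul, moveToBob_eq]
  simp only [Matrix.mul_assoc]

lemma HasLocalExpansion.moveToAlice {Ψ : X → Y → Matrix (Qubits p) (Qubits (q + 1)) ℂ}
    (h : HasLocalExpansion ψ N Ψ) (V : Y → unitaryGroup (Qubits (q + 1)) ℂ) :
    HasLocalExpansion (m := Qubits (p + 1)) (n := Qubits q) ψ (2 * N) fun x y =>
      JointState.moveToAlice (JointState.actBob (V y) (Ψ x y)) := by
  have hF : ∀ (β : Bool) y,
      ‖(V y : Matrix (Qubits (q + 1)) (Qubits (q + 1)) ℂ)ᵀ * (cutQubit q β)ᴴ‖ ≤ 1 :=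
    fun β y => norm_mul_le_one (norm_transpose_unitary_le_one (V y))
      (norm_conjTranspose_le_one (norm_cutQubit_le_one _ β))
  refine (h.sum_mul (fun β _ => (cutQubit p β)ᴴ) _
    (fun β x => norm_conjTranspose_le_one (norm_cutQubit_le_one _ β)) hF).congr fun x y => ?_
  rw [actBob_eq_mul, moveToAlice_eq]
  simp only [Matrix.mul_assoc]

/-- Kremer–Yao decomposition of the acceptance probabilities of a quantum protocol. -/
lemma QuantumProtocol.hasTraceExpansion_probOne (P : QuantumProtocol X Y p q) :
    ∀ {N : ℕ} {Ψ : X → Y → JointState p q}, HasLocalExpansion ψ N Ψ →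
      HasTraceExpansion ψ (4 ^ P.cost * (N * N)) fun x y => ((P.probOne x y (Ψ x y) : ℝ) : ℂ) := by
  induction P with
  | aliceOutputs U =>
    intro N Ψ h
    rw [cost, pow_zero, one_mul]
    exact h.probAliceOne U
  | bobOutputs V =>
    intro N Ψ h
    rw [cost, pow_zero, one_mul]
    exact h.probBobOne V
  | aliceSends U next ih =>
    intro N Ψ h
    -- A message doubles `N`, hence quadruples the number of trace terms.
    rw [cost, show 4 ^ (next.cost + 1) * (N * N) = 4 ^ next.cost * ((2 * N) * (2 * N)) by ring]
    exact ih (h.moveToBob U)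
  | bobSends V next ih =>
    intro N Ψ h
    rw [cost, show 4 ^ (next.cost + 1) * (N * N) = 4 ^ next.cost * ((2 * N) * (2 * N)) by ring]
    exact ih (h.moveToAlice V)

end Steps

/-- Discrepancy bound for the acceptance probabilities of a quantum protocol. -/
lemma QuantumProtocol.norm_sum_mul_probOne_le {X Y X' Y' : Type} [Fintype X] [Fintype Y]
    [DecidableEq X] [DecidableEq Y] {p q : ℕ} (P : QuantumProtocol X' Y' p q) (ψ : JointState p q)
    (hψ : ψ.normSq ≤ 1) (g : X → X') (k : Y → Y') (H : Matrix X Y ℂ) :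
    ‖∑ x, ∑ y, H x y * ((P.probOne (g x) (k y) ψ : ℝ) : ℂ)‖ ≤
      4 ^ P.cost * (‖H‖ * (√(Fintype.card X) * √(Fintype.card Y))) := by
  have h0 : HasLocalExpansion (X := X') (Y := Y') (ψ : Matrix _ _ ℂ) 1 (fun _ _ => ψ) :=
    ⟨Unit, inferInstance, fun _ _ => 1, fun _ _ => 1, by simp, fun _ _ => norm_one_le_one,
      fun _ _ => norm_one_le_one, by simp⟩
  obtain ⟨T, i, A, B, hT, hA, hB, hp⟩ := P.hasTraceExpansion_probOne h0
  have h1 : HasTraceExpansion (ψ : Matrix _ _ ℂ) (4 ^ P.cost)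
      (fun x y => ((P.probOne (g x) (k y) ψ : ℝ) : ℂ)) :=
    ⟨T, i, fun t x => A t (g x), fun t y => B t (k y), by simpa using hT, fun _ _ => hA _ _,
      fun _ _ => hB _ _, fun x y => hp _ _⟩
  exact_mod_cast h1.norm_sum_le hψ H

end LocalExpansion

/-! ### Quantum lower bound for the inner product modulo two. -/

section InnerProduct

open Matrix
open scoped Matrix.Norms.L2Operator

/-- The sign `(-1) ^ ⟨x, y⟩`. -/
def innerSign {N : ℕ} (x y : Fin N → Bool) : ℝ := ∏ i, if (x i && y i) = true then -1 else 1

/-- The Hadamard matrix of order `2 ^ N`. -/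
def hadamardMatrix (N : ℕ) : Matrix (Fin N → Bool) (Fin N → Bool) ℂ :=
  fun x y => (innerSign x y : ℂ)

lemma hadamardMatrix_conjTranspose_mul_self (N : ℕ) :
    (hadamardMatrix N)ᴴ * hadamardMatrix N = (2 ^ N : ℂ) • 1 := by
  ext y y'
  have h : ∀ i, ∑ b : Bool, ((if (b && y i) = true then -1 else 1 : ℂ) *
      (if (b && y' i) = true then -1 else 1)) = if y i = y' i then 2 else 0 := by
    intro i
    cases y i <;> cases y' i <;> norm_num
  have e : ((hadamardMatrix N)ᴴ * hadamardMatrix N) y y' =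
      ∏ i, ∑ b : Bool, ((if (b && y i) = true then -1 else 1 : ℂ) *
      (if (b && y' i) = true then -1 else 1)) := by
    rw [Finset.prod_univ_sum, Fintype.piFinset_univ, mul_apply]
    refine Finset.sum_congr rfl fun x _ => ?_
    rw [conjTranspose_apply, Finset.prod_mul_distrib]
    simp only [hadamardMatrix, innerSign, Complex.star_def, Complex.conj_ofReal]
    simp only [Complex.ofReal_prod, apply_ite Complex.ofReal, Complex.ofReal_neg,
      Complex.ofReal_one]
  rw [e]
  simp only [h]
  rw [Matrix.smul_apply, one_apply]
  by_cases hy : y = y'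
  · simp [hy]
  · obtain ⟨i, hi⟩ := Function.ne_iff.1 hy
    simp only [hy, if_false, smul_zero]
    exact Finset.prod_eq_zero (Finset.mem_univ i) (by simp [hi])

lemma norm_hadamardMatrix_le (N : ℕ) : ‖hadamardMatrix N‖ ≤ √(2 ^ N) := by
  refine Real.le_sqrt_of_sq_le ?_
  have h := l2_opNorm_conjTranspose_mul_self (hadamardMatrix N)
  rw [sq, ← h, hadamardMatrix_conjTranspose_mul_self, norm_smul]
  have h1 : ‖(2 ^ N : ℂ)‖ = 2 ^ N := by simp
  rw [h1]
  exact mul_le_of_le_one_right (by positivity) norm_one_le_one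

lemma innerSign_eq (N : ℕ) (x y : Fin N → Bool) : innerSign x y = 1 ∨ innerSign x y = -1 := by
  unfold innerSign
  refine Finset.prod_induction _ (fun r : ℝ => r = 1 ∨ r = -1) ?_ (Or.inl rfl) ?_
  · rintro a b (rfl | rfl) (rfl | rfl) <;> norm_num
  · intro i _
    split_ifs <;> simp

/-- A quantum protocol with prior entanglement that computes the inner product modulo two of
`N`-bit strings, possibly encoded, sends at least `N / 4 - 2` qubits. -/
lemma QuantumProtocol.cost_ge_of_computes_innerSign {X Y : Type} {p q N : ℕ}
    (P : QuantumProtocol X Y p q) (ψ : JointState p q) (hψ : ψ.normSq = 1) {S f : X → Y → Prop}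
    (hP : P.Computes ψ S f) (g : (Fin N → Bool) → X) (k : (Fin N → Bool) → Y)
    (hS : ∀ x y, S (g x) (k y)) (hf : ∀ x y, f (g x) (k y) ↔ innerSign x y = 1) :
    N ≤ 4 * P.cost + 7 := by
  set D : ℝ := 2 ^ N with hD
  have hD0 : 0 < D := by positivity
  have hcard : (Fintype.card (Fin N → Bool) : ℝ) = D := by simp [hD]
  have hss : √D * √D = D := Real.mul_self_sqrt hD0.le
  have hsq0 : 0 < √D := Real.sqrt_pos.2 hD0
  have b1 := P.norm_sum_mul_probOne_le ψ hψ.le g k (hadamardMatrix N)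
  -- All-ones vectors: the signs themselves nearly cancel, so the threshold `1 / 2` can be
  -- subtracted from the probabilities.
  have b2 := norm_sum_mul_bilinear_le (I := Unit) (hadamardMatrix N)
    (fun _ _ => 1) (fun _ _ => 1) (by simp) (by simp)
  rw [hcard, hss] at b1 b2
  have hN := norm_hadamardMatrix_le N
  rw [← hD] at hN
  have e1 : (∑ x, ∑ y, hadamardMatrix N x y * ((P.probOne (g x) (k y) ψ : ℝ) : ℂ)) =
      ((∑ x, ∑ y, innerSign x y * P.probOne (g x) (k y) ψ : ℝ) : ℂ) := by
    push_cast; rfl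
  have e2 : (∑ x, ∑ y, hadamardMatrix N x y * ∑ i : Unit, (1 : ℂ) * 1) =
      ((∑ x : Fin N → Bool, ∑ y, innerSign x y : ℝ) : ℂ) := by
    push_cast; simp [hadamardMatrix]
  rw [e1, Complex.norm_real] at b1
  rw [e2, Complex.norm_real] at b2
  have b1' := (le_abs_self _).trans b1
  have b2' := (neg_le_abs _).trans b2
  -- On every input the probability differs from `1 / 2` by at least `1 / 6`, in the direction of
  -- the sign.
  have b3 : D * D / 6 ≤ (∑ x, ∑ y, innerSign x y * P.probOne (g x) (k y) ψ) -
      (1 / 2) * ∑ x : Fin N → Bool, ∑ y, innerSign x y := by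
    have : D * D / 6 = ∑ _x : Fin N → Bool, ∑ _y : Fin N → Bool, (1 / 6 : ℝ) := by
      simp [hD]; ring
    rw [this]
    simp only [Finset.mul_sum, ← Finset.sum_sub_distrib]
    refine Finset.sum_le_sum fun x _ => Finset.sum_le_sum fun y _ => ?_
    obtain ⟨h1, h2⟩ := hP (g x) (k y) (hS x y)
    rcases innerSign_eq N x y with h | h
    · have := h1 ((hf x y).2 h)
      rw [h]; linarith
    · have := h2 (fun h' => by rw [hf, h] at h'; norm_num at h')
      rw [h]; linarith
  have hc : (1 : ℝ) ≤ 4 ^ P.cost := one_le_pow₀ (by norm_num)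
  have b4 : ‖hadamardMatrix N‖ * D ≤ √D * D := by gcongr
  have b5 : (4 : ℝ) ^ P.cost * (‖hadamardMatrix N‖ * D) ≤ 4 ^ P.cost * (√D * D) := by gcongr
  have b6 : √D * D ≤ 4 ^ P.cost * (√D * D) := le_mul_of_one_le_left (by positivity) hc
  have b7 : D * D ≤ 9 * 4 ^ P.cost * √D * D := by linarith
  have b8 : D ≤ 9 * 4 ^ P.cost * √D := le_of_mul_le_mul_right b7 hD0
  have b9 : √D ≤ 9 * 4 ^ P.cost := by
    refine le_of_mul_le_mul_right (a := √D) ?_ hsq0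
    rwa [hss]
  have b10 : D ≤ 81 * 16 ^ P.cost := by
    calc D = √D * √D := hss.symm
      _ ≤ (9 * 4 ^ P.cost) * (9 * 4 ^ P.cost) := by gcongr
      _ = 81 * 16 ^ P.cost := by rw [show (16 : ℝ) = 4 * 4 by norm_num, mul_pow]; ring
  -- The 7 comes from `81 ≤ 2 ^ 7`.
  have b11 : (2 : ℝ) ^ N ≤ 2 ^ (4 * P.cost + 7) := by
    rw [pow_add, pow_mul]
    norm_num
    have : (0 : ℝ) < 16 ^ P.cost := by positivity
    linarith
  exact (pow_le_pow_iff_right₀ (by norm_num : (1 : ℝ) < 2)).1 b11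

end InnerProduct

/-! ### Reduction of the inner product to connectivity. -/

section Gadget

/-- The permutation of the four tracks that exchanges `0 ↔ 1` and `2 ↔ 3`. -/
def aliceSwap : Fin 4 → Fin 4 := ![1, 0, 3, 2]

/-- The permutation of the four tracks that exchanges `0 ↔ 2`. -/
def bobSwap : Fin 4 → Fin 4 := ![2, 1, 0, 3]

/-- The inner product modulo two of the first `i` bits. -/
def innerParity (x y : ℕ → Bool) : ℕ → Bool
  | 0 => false
  | i + 1 => xor (innerParity x y i) (x i && y i)

/-- The track in layer `l` of the parent of the vertex of track `t` in layer `l + 1`. -/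
def stepTrack (x y : ℕ → Bool) (l : ℕ) (t : Fin 4) : Fin 4 :=
  if l % 2 = 0 then (if x (l / 4) = true then aliceSwap t else t)
  else (if y (l / 4) = true then bobSwap t else t)

/-- The track in layer `0` of the root of the vertex of track `t` in layer `l`. -/
def rootTrack (x y : ℕ → Bool) : ℕ → Fin 4 → Fin 4
  | 0, t => t
  | l + 1, t => rootTrack x y l (stepTrack x y l t)

/-- Both swaps are involutions, so the four steps compose to their commutator if both bits are 1,
namely the square `(0 2)(1 3)` of a 4-cycle, and cancel otherwise. -/
lemma stepTrack_four (x y : ℕ → Bool) (i : ℕ) (t : Fin 4) :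
    stepTrack x y (4 * i) (stepTrack x y (4 * i + 1) (stepTrack x y (4 * i + 2)
      (stepTrack x y (4 * i + 3) t))) = if (x i && y i) = true then t + 2 else t := by
  have h0 : 4 * i / 4 = i := by omega
  have h1 : (4 * i + 1) / 4 = i := by omega
  have h2 : (4 * i + 2) / 4 = i := by omega
  have h3 : (4 * i + 3) / 4 = i := by omega
  have p0 : 4 * i % 2 = 0 := by omega
  have p1 : (4 * i + 1) % 2 = 1 := by omega
  have p2 : (4 * i + 2) % 2 = 0 := by omega
  have p3 : (4 * i + 3) % 2 = 1 := by omega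
  simp only [stepTrack, h0, h1, h2, h3, p0, p1, p2, p3]
  generalize x i = a
  generalize y i = b
  revert a b t
  decide

lemma rootTrack_four_mul (x y : ℕ → Bool) (i : ℕ) :
    ∀ t, rootTrack x y (4 * i) t = if innerParity x y i = true then t + 2 else t := by
  induction i with
  | zero => intro t; simp [rootTrack, innerParity]
  | succ i ih =>
    intro t
    rw [show 4 * (i + 1) = 4 * i + 3 + 1 from rfl]
    simp only [rootTrack]
    rw [ih, stepTrack_four, innerParity]
    generalize (x i && y i) = a
    generalize innerParity x y i = b
    revert a b t
    decide

/-- The parent of vertex `k`, which is the vertex of track `k % 4` in layer `k / 4`. The roots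
`0, 1` and `2, 3` are joined, and the vertex of track `2` in layer `4 * N` is joined to `0`. -/
def parentVertex (x y : ℕ → Bool) (N k : ℕ) : ℕ :=
  if k < 4 then (if k = 0 then 16 * N + 2 else if k = 1 then 0 else 2)
  else 4 * (k / 4 - 1) + (stepTrack x y (k / 4 - 1) (Fin.ofNat 4 k) : ℕ)

/-- Alice owns the edges from the layers of odd index to their predecessors and those that join
roots; Bob owns the others. -/
def aliceOwns (k : ℕ) : Prop := k < 4 ∨ k / 4 % 2 = 1

/-- The graph that joins those vertices that satisfy `S` to their parents. -/
def parentGraph {n : ℕ} (par : ℕ → ℕ) (S : ℕ → Prop) : SimpleGraph (Fin n) where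
  Adj i j := i ≠ j ∧ ((S i ∧ par i = j) ∨ (S j ∧ par j = i))
  symm := ⟨fun _ _ h => ⟨h.1.symm, h.2.symm⟩⟩
  loopless := ⟨fun _ h => h.1 rfl⟩

variable {n N : ℕ} {x x' y y' : ℕ → Bool}

lemma parentVertex_congr_alice {k : ℕ} (hk : aliceOwns k) :
    parentVertex x y N k = parentVertex x y' N k := by
  unfold parentVertex
  split_ifs with h <;> try rfl
  have : (k / 4 - 1) % 2 = 0 := by unfold aliceOwns at hk; omega
  simp [stepTrack, this]

lemma parentVertex_congr_bob {k : ℕ} (hk : ¬ aliceOwns k) :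
    parentVertex x y N k = parentVertex x' y N k := by
  unfold aliceOwns at hk
  have h1 : ¬ k < 4 := by omega
  have : (k / 4 - 1) % 2 = 1 := by omega
  simp [parentVertex, h1, stepTrack, this]

/-- Alice's edges. -/
def aliceGraph (n N : ℕ) (x : ℕ → Bool) : SimpleGraph (Fin n) :=
  parentGraph (parentVertex x (fun _ => false) N) aliceOwns

/-- Bob's edges. -/
def bobGraph (n N : ℕ) (y : ℕ → Bool) : SimpleGraph (Fin n) :=
  parentGraph (parentVertex (fun _ => false) y N) fun k => ¬ aliceOwns k

lemma aliceGraph_sup_bobGraph :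
    aliceGraph n N x ⊔ bobGraph n N y = parentGraph (parentVertex x y N) fun _ => True := by
  ext i j
  simp only [SimpleGraph.sup_adj, aliceGraph, bobGraph, parentGraph, true_and]
  have ha : ∀ k, aliceOwns k → parentVertex x (fun _ => false) N k = parentVertex x y N k :=
    fun k hk => parentVertex_congr_alice hk
  have hb : ∀ k, ¬ aliceOwns k → parentVertex (fun _ => false) y N k = parentVertex x y N k :=
    fun k hk => parentVertex_congr_bob hk
  by_cases hi : aliceOwns i <;> by_cases hj : aliceOwns j <;> simp_all <;> tauto

/-- Every edge comes from a vertex and its parent. Reduction modulo `n` only makes the map total. -/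
lemma parentGraph_edgeSet_subset (hn : 0 < n) (par : ℕ → ℕ) (S : ℕ → Prop) :
    (parentGraph (n := n) par S).edgeSet ⊆
      Set.range fun k : Fin n => s(k, ⟨par k % n, Nat.mod_lt _ hn⟩) := by
  intro e he
  induction e with | _ i j =>
  rw [SimpleGraph.mem_edgeSet] at he
  rcases he.2 with ⟨-, h⟩ | ⟨-, h⟩
  · refine ⟨i, ?_⟩
    simp only [h, Nat.mod_eq_of_lt j.isLt]
  · refine ⟨j, ?_⟩
    simp only [h, Nat.mod_eq_of_lt i.isLt]
    exact Sym2.eq_swap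

lemma parentGraph_edgeSet_ncard_le (par : ℕ → ℕ) (S : ℕ → Prop) :
    (parentGraph (n := n) par S).edgeSet.ncard ≤ n := by
  rcases Nat.eq_zero_or_pos n with rfl | hn
  · have : IsEmpty (Sym2 (Fin 0)) := by
      refine ⟨fun e => ?_⟩
      induction e with | _ i j => exact i.elim0
    simp [Set.eq_empty_of_isEmpty]
  · refine (Set.ncard_le_ncard (parentGraph_edgeSet_subset hn par S)
      (Set.finite_range _)).trans ?_
    rw [← Set.image_univ]
    refine (Set.ncard_image_le Set.finite_univ).trans ?_
    simp [Set.ncard_univ]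

/-- A shared edge would join two vertices that are each other's parents, one owned by each party;
the layers exclude this. -/
lemma disjoint_aliceGraph_bobGraph :
    Disjoint (aliceGraph n N x).edgeSet (bobGraph n N y).edgeSet := by
  rw [Set.disjoint_left]
  intro e ha hb
  induction e with | _ i j =>
  have key : ∀ i j : ℕ, aliceOwns i → parentVertex x (fun _ => false) N i = j → ¬ aliceOwns j →
      parentVertex (fun _ => false) y N j = i → False := by
    intro i j hi hij hj hji
    unfold aliceOwns at hi hj
    unfold parentVertex at hij hji
    have h1 := (stepTrack x (fun _ => false) (i / 4 - 1) (Fin.ofNat 4 i)).isLt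
    have h2 := (stepTrack (fun _ => false) y (j / 4 - 1) (Fin.ofNat 4 j)).isLt
    split_ifs at hij hji <;> omega
  rw [SimpleGraph.mem_edgeSet] at ha hb
  rcases ha.2 with ⟨h1, h2⟩ | ⟨h1, h2⟩ <;> rcases hb.2 with ⟨h3, h4⟩ | ⟨h3, h4⟩
  · exact h3 h1
  · exact key _ _ h1 h2 h3 h4
  · exact key _ _ h1 h2 h3 h4
  · exact h3 h1

/-- The root below vertex `k`. -/
def rootVertex (x y : ℕ → Bool) (k : ℕ) : Fin 4 := rootTrack x y (k / 4) (Fin.ofNat 4 k)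

lemma rootVertex_parentVertex {k : ℕ} (hk : 4 ≤ k) :
    rootVertex x y (parentVertex x y N k) = rootVertex x y k := by
  have h4 : ¬ k < 4 := by omega
  obtain ⟨l, hl⟩ : ∃ l, k / 4 = l + 1 := ⟨k / 4 - 1, by omega⟩
  have ht := (stepTrack x y l (Fin.ofNat 4 k)).isLt
  simp only [rootVertex, parentVertex, h4, hl, if_false, Nat.add_sub_cancel, rootTrack]
  rw [show (4 * l + (stepTrack x y l (Fin.ofNat 4 k) : ℕ)) / 4 = l by omega]
  congr 1
  ext
  simp [Fin.ofNat]

lemma parentGraph_adj {par : ℕ → ℕ} {i j : Fin n} (h : par i = j) (hij : i ≠ j) :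
    (parentGraph (n := n) par fun _ => True).Adj i j := ⟨hij, Or.inl ⟨trivial, h⟩⟩

lemma reachable_rootVertex (hn : 16 * N + 3 ≤ n) (hN : 1 ≤ N) : ∀ (k : ℕ) (hk : k < n),
    (parentGraph (n := n) (parentVertex x y N) fun _ => True).Reachable ⟨k, hk⟩
      ⟨rootVertex x y k, by have := (rootVertex x y k).isLt; omega⟩ := by
  intro k
  induction k using Nat.strong_induction_on with
  | _ k ih =>
    intro hk
    by_cases h4 : k < 4
    · have : (rootVertex x y k : ℕ) = k := by
        have : k / 4 = 0 := by omega
        simp [rootVertex, this, rootTrack, Fin.ofNat, Nat.mod_eq_of_lt h4]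
      simp only [this]
      exact SimpleGraph.Reachable.refl _
    · have hlt : parentVertex x y N k < k := by
        have := (stepTrack x y (k / 4 - 1) (Fin.ofNat 4 k)).isLt
        simp only [parentVertex, h4, if_false]
        omega
      have := ih _ hlt (hlt.trans hk)
      simp only [rootVertex_parentVertex (N := N) (by omega : 4 ≤ k)] at this
      refine SimpleGraph.Reachable.trans (SimpleGraph.Adj.reachable ?_) this
      exact parentGraph_adj rfl (by simp [Fin.ext_iff]; omega)

lemma rootVertex_closing : rootVertex x y (16 * N + 2) =
    if innerParity x y N = true then 0 else 2 := by
  have h1 : (16 * N + 2) / 4 = 4 * N := by omega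
  have h2 : Fin.ofNat 4 (16 * N + 2) = 2 := by ext; simp [Fin.ofNat]; omega
  rw [rootVertex, h1, h2, rootTrack_four_mul]
  rfl

/-- Without the closing edge there are two components, one above the roots `0, 1` and one above `2,
3`; surplus vertices merely continue the layers. The closing edge leads from `0` to a vertex above
`2` or above `0`, according to the parity. -/
lemma connected_gadget_iff (hn : 16 * N + 3 ≤ n) (hN : 1 ≤ N) :
    (aliceGraph n N x ⊔ bobGraph n N y).Connected ↔ innerParity x y N = false := by
  rw [aliceGraph_sup_bobGraph]
  constructor
  · intro h
    by_contra hp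
    rw [Bool.not_eq_false] at hp
    -- Division by 2 separates the roots `0, 1` from `2, 3`; for odd parity this is invariant even
    -- under the closing edge.
    have hc : ∀ k : ℕ, (rootVertex x y (parentVertex x y N k)).val / 2 =
        (rootVertex x y k).val / 2 := by
      intro k
      by_cases h4 : 4 ≤ k
      · rw [rootVertex_parentVertex h4]
      · have : k = 0 ∨ k = 1 ∨ k = 2 ∨ k = 3 := by omega
        rcases this with rfl | rfl | rfl | rfl
        · simp only [parentVertex, if_true, Nat.zero_lt_succ]
          rw [rootVertex_closing, hp]
          rfl
        all_goals norm_num [parentVertex, rootVertex, rootTrack, Fin.ofNat]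
    have hadj : ∀ i j : Fin n, (parentGraph (n := n) (parentVertex x y N) fun _ => True).Adj i j →
        (rootVertex x y i).val / 2 = (rootVertex x y j).val / 2 := by
      rintro i j ⟨-, ⟨-, h⟩ | ⟨-, h⟩⟩
      · rw [← h, hc]
      · rw [← h, hc]
    have hr : ∀ i j : Fin n, (rootVertex x y i).val / 2 = (rootVertex x y j).val / 2 := by
      intro i j
      obtain ⟨w⟩ := h.preconnected i j
      induction w with
      | nil => rfl
      | cons h' _ ih => exact (hadj _ _ h').trans ih
    have := hr ⟨0, by omega⟩ ⟨2, by omega⟩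
    exact absurd this (by simp [rootVertex, rootTrack, Fin.ofNat])
  · intro hp
    set G := parentGraph (n := n) (parentVertex x y N) fun _ => True with hG
    have r1 : G.Reachable ⟨1, by omega⟩ ⟨0, by omega⟩ :=
      (parentGraph_adj rfl (by simp)).reachable
    have r3 : G.Reachable ⟨3, by omega⟩ ⟨2, by omega⟩ :=
      (parentGraph_adj rfl (by simp)).reachable
    have r0 : G.Reachable ⟨0, by omega⟩ ⟨16 * N + 2, by omega⟩ :=
      (parentGraph_adj rfl (by simp)).reachable
    have r2 : G.Reachable ⟨2, by omega⟩ ⟨0, by omega⟩ := by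
      have := reachable_rootVertex (x := x) (y := y) hn hN (16 * N + 2) (by omega)
      simp only [rootVertex_closing, hp] at this
      exact (r0.trans this).symm
    have hz : ∀ k : Fin n, G.Reachable k ⟨0, by omega⟩ := by
      intro k
      have ht : ∀ t : Fin 4, G.Reachable ⟨t, by omega⟩ ⟨0, by omega⟩ := by
        intro t
        fin_cases t
        · exact SimpleGraph.Reachable.refl _
        · exact r1
        · exact r2
        · exact r3.trans r2
      exact (reachable_rootVertex hn hN k k.isLt).trans (ht _)
    have : Nonempty (Fin n) := ⟨⟨0, by omega⟩⟩
    exact ⟨fun i j => (hz i).trans (hz j).symm⟩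

end Gadget

/-! ### Rank of the connectivity matrix and the partition lattice. -/

section ConnectedRank

open Polynomial

/-- The inputs that reach a given leaf form a rectangle, so each leaf contributes a term of rank at
most one. -/
lemma DetProtocol.exists_output_eq_sum {X Y : Type} (P : DetProtocol X Y) :
    ∃ (T : Type) (_ : Fintype T) (u : X → T → ℚ) (v : T → Y → ℚ), Fintype.card T ≤ 2 ^ P.cost ∧
      ∀ x y, (if P.output x y = true then 1 else 0) = ∑ t, u x t * v t y := by
  induction P with
  | leaf out =>
    refine ⟨Unit, inferInstance, fun _ _ => if out = true then 1 else 0, fun _ _ => 1,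
      by simp [cost], fun x y => by cases out <;> simp [output]⟩
  | aliceSends bit next ih =>
    obtain ⟨T₀, _, u₀, v₀, h₀, e₀⟩ := ih false
    obtain ⟨T₁, _, u₁, v₁, h₁, e₁⟩ := ih true
    refine ⟨T₀ ⊕ T₁, inferInstance,
      fun x => Sum.elim (fun t => if bit x = true then 0 else u₀ x t)
        (fun t => if bit x = true then u₁ x t else 0), Sum.elim v₀ v₁, ?_, fun x y => ?_⟩
    · rw [Fintype.card_sum, cost, add_comm 1, pow_succ, mul_two]
      exact add_le_add (h₀.trans (Nat.pow_le_pow_right two_pos (le_max_left _ _)))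
        (h₁.trans (Nat.pow_le_pow_right two_pos (le_max_right _ _)))
    · rw [output]
      cases h : bit x <;> simp [h, e₀, e₁]
  | bobSends bit next ih =>
    obtain ⟨T₀, _, u₀, v₀, h₀, e₀⟩ := ih false
    obtain ⟨T₁, _, u₁, v₁, h₁, e₁⟩ := ih true
    refine ⟨T₀ ⊕ T₁, inferInstance, fun x => Sum.elim (u₀ x) (u₁ x),
      Sum.elim (fun t y => if bit y = true then 0 else v₀ t y)
        (fun t y => if bit y = true then v₁ t y else 0), ?_, fun x y => ?_⟩
    · rw [Fintype.card_sum, cost, add_comm 1, pow_succ, mul_two]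
      exact add_le_add (h₀.trans (Nat.pow_le_pow_right two_pos (le_max_left _ _)))
        (h₁.trans (Nat.pow_le_pow_right two_pos (le_max_right _ _)))
    · rw [output]
      cases h : bit y <;> simp [h, e₀, e₁]

lemma descPochhammer_eval_neg_one_ne_zero (k : ℕ) : (descPochhammer ℚ k).eval (-1) ≠ 0 := by
  rw [descPochhammer_eval_eq_prod_range]
  refine Finset.prod_ne_zero_iff.2 fun i _ h => ?_
  have : (0 : ℚ) ≤ i := Nat.cast_nonneg i
  linarith

/-- Dividing by `X` and evaluating at 0 leaves a product of the factors `-1 - i`. -/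
lemma descPochhammer_coeff_one_ne_zero {k : ℕ} (hk : k ≠ 0) : (descPochhammer ℚ k).coeff 1 ≠ 0 := by
  obtain ⟨k, rfl⟩ := Nat.exists_eq_succ_of_ne_zero hk
  rw [descPochhammer_succ_left, coeff_X_mul, coeff_zero_eq_eval_zero, eval_comp]
  simpa using descPochhammer_eval_neg_one_ne_zero k

instance {α : Type*} [Finite α] : Finite (Setoid α) :=
  Finite.of_injective (fun r : Setoid α => r.r) fun _ _ h => Setoid.ext fun a b => by
    exact iff_of_eq (congr_fun₂ h a b)

noncomputable instance {α : Type*} [Finite α] : Fintype (Setoid α) := Fintype.ofFinite _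

variable {α : Type} [Finite α]

/-- Functions with kernel `r` are injective functions on the quotient. -/
noncomputable def kerEqEquiv (β : Type) (r : Setoid α) :
    {f : α → β // Setoid.ker f = r} ≃ (Quotient r ↪ β) where
  toFun f := ⟨Quotient.lift f.1 fun a b h => by
      have h' : r a b := h
      rw [← f.2] at h'
      exact h', by
    intro a b
    induction a, b using Quotient.inductionOn₂ with | _ a b =>
    intro h
    refine Quotient.sound ?_
    have h' : Setoid.ker f.1 a b := h
    rw [f.2] at h'
    exact h'⟩
  invFun g := ⟨fun a => g (Quotient.mk r a), by
    ext a b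
    rw [Setoid.ker_def, g.injective.eq_iff]
    exact Quotient.eq⟩
  left_inv f := by ext; rfl
  right_inv g := by
    ext a
    induction a using Quotient.inductionOn
    rfl

-- At `X = m` both sides count the maps `α → Fin m` that are constant on the classes of `s`, on the
-- left sorted by their kernel `r`.
open Classical in
lemma sum_descPochhammer_eq_X_pow (s : Setoid α) :
    ∑ r : Setoid α, (if s ≤ r then descPochhammer ℚ (Nat.card (Quotient r)) else 0) =
      X ^ Nat.card (Quotient s) := by
  refine eq_of_infinite_eval_eq _ _ ((Set.infinite_range_of_injective
    (Nat.cast_injective (R := ℚ))).mono ?_)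
  rintro _ ⟨m, rfl⟩
  have : Fintype α := Fintype.ofFinite α
  simp only [Set.mem_ofPred_eq, eval_finsetSum, eval_pow, eval_X, apply_ite (eval (m : ℚ)),
    eval_zero, descPochhammer_eval_eq_descFactorial]
  have hA : m ^ Nat.card (Quotient s) = Fintype.card {f : α → Fin m // s ≤ Setoid.ker f} := by
    rw [Fintype.card_congr (Setoid.liftEquiv s), ← Nat.card_eq_fintype_card, Nat.card_fun]
    simp
  have hB : ∀ r : Setoid α, m.descFactorial (Nat.card (Quotient r)) =
      Fintype.card {f : α → Fin m // Setoid.ker f = r} := by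
    intro r
    rw [Fintype.card_congr (kerEqEquiv (Fin m) r), Fintype.card_embedding_eq]
    simp
  have hC : Fintype.card {f : α → Fin m // s ≤ Setoid.ker f} =
      ∑ r : Setoid α, if s ≤ r then Fintype.card {f : α → Fin m // Setoid.ker f = r} else 0 := by
    rw [Fintype.card_subtype, Finset.card_eq_sum_card_fiberwise (f := fun f => Setoid.ker f)
      (t := Finset.univ) (fun _ _ => Finset.mem_univ _)]
    refine Finset.sum_congr rfl fun r _ => ?_
    split_ifs with h
    · rw [Fintype.card_subtype, Finset.filter_filter]
      congr 1
      ext f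
      simp only [Finset.mem_filter, Finset.mem_univ, true_and, and_iff_right_iff_imp]
      rintro rfl
      exact h
    · rw [Finset.card_eq_zero, Finset.filter_filter, Finset.filter_eq_empty_iff]
      rintro f - ⟨h1, rfl⟩
      exact h h1
  rw [← Nat.cast_pow, hA, hC]
  push_cast
  exact Finset.sum_congr rfl fun r _ => by rw [hB r]

lemma natCard_quotient_eq_one_iff {β : Type*} [Nonempty β] (s : Setoid β) :
    Nat.card (Quotient s) = 1 ↔ s = ⊤ := by
  rw [Nat.card_eq_one_iff_unique]
  constructor
  · rintro ⟨h, -⟩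
    ext a b
    exact ⟨fun _ => trivial, fun _ => Quotient.exact (h.elim _ _)⟩
  · rintro rfl
    exact ⟨⟨fun a b => Quotient.inductionOn₂ a b fun _ _ => Quotient.sound trivial⟩,
      ⟨Quotient.mk _ (Classical.arbitrary β)⟩⟩

open Classical in
/-- The matrix with entries `[r ⊔ s = ⊤]`, indexed by equivalence relations, is nonsingular. -/
lemma eq_zero_of_sum_sup_eq_top [Nonempty α] (c : Setoid α → ℚ)
    (hc : ∀ s, ∑ r, c r * (if r ⊔ s = ⊤ then 1 else 0) = 0) : c = 0 := by
  -- This is the Möbius function `μ(r, ⊤)` of the partition lattice: `hsum` compares linear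
  -- coefficients in `sum_descPochhammer_eq_X_pow`.
  set m : Setoid α → ℚ := fun r => (descPochhammer ℚ (Nat.card (Quotient r))).coeff 1 with hm
  have hm0 : ∀ r, m r ≠ 0 := fun r => by
    have : Nonempty (Quotient r) := ⟨Quotient.mk _ (Classical.arbitrary α)⟩
    exact descPochhammer_coeff_one_ne_zero Nat.card_pos.ne'
  have hsum : ∀ s : Setoid α, (if s = ⊤ then 1 else 0) = ∑ r, if s ≤ r then m r else 0 := by
    intro s
    have := congr_arg (fun p : ℚ[X] => p.coeff 1) (sum_descPochhammer_eq_X_pow s)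
    simp only [finsetSum_coeff, coeff_X_pow, apply_ite (fun p : ℚ[X] => p.coeff 1),
      coeff_zero] at this
    rw [this]
    exact if_congr ((natCard_quotient_eq_one_iff s).symm.trans eq_comm) rfl rfl
  -- `[r ⊔ s = ⊤]` is the sum of `m t` over the common upper bounds `t` of `r` and `s`: a product of
  -- two zeta matrices with the diagonal matrix `m` in between. The zeta factors are triangular, so
  -- one induction from the top and one from the bottom remove them.
  have hg : ∀ s : Setoid α, ∑ t, (if s ≤ t then m t * ∑ r, (if r ≤ t then c r else 0) else 0) = 0 := by
    intro s
    refine Eq.trans ?_ (hc s)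
    simp only [hsum, Finset.mul_sum]
    rw [Finset.sum_comm]
    refine Finset.sum_congr rfl fun t _ => ?_
    simp only [sup_le_iff]
    by_cases h1 : s ≤ t
    · simp only [h1, if_true, and_true]
      exact Finset.sum_congr rfl fun r _ => by split_ifs <;> ring
    · simp [h1]
  have hG : ∀ t : Setoid α, ∑ r, (if r ≤ t then c r else 0) = 0 := by
    intro t
    induction t using WellFoundedGT.induction with
    | ind t ih =>
      have := hg t
      rw [Finset.sum_eq_single t] at this
      · simpa [hm0 t] using this
      · intro s _ hst
        split_ifs with h
        · rw [ih s (lt_of_le_of_ne h hst.symm), mul_zero]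
        · rfl
      · simp
  funext t
  induction t using WellFoundedLT.induction with
  | ind t ih =>
    have := hG t
    rw [Finset.sum_eq_single t] at this
    · simpa using this
    · intro s _ hst
      split_ifs with h
      · rw [ih s (lt_of_le_of_ne h hst)]; rfl
      · rfl
    · simp

/-- The graph in which the related pairs of distinct vertices are adjacent. -/
def Setoid.toSimpleGraph {V : Type*} (r : Setoid V) : SimpleGraph V where
  Adj a b := a ≠ b ∧ r a b
  symm := ⟨fun _ _ h => ⟨h.1.symm, r.symm h.2⟩⟩
  loopless := ⟨fun _ h => h.1 rfl⟩

lemma SimpleGraph.reachableSetoid_le_iff {V : Type*} (G : SimpleGraph V) (r : Setoid V) :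
    G.reachableSetoid ≤ r ↔ ∀ a b, G.Adj a b → r a b := by
  constructor
  · exact fun h a b hab => h hab.reachable
  · rintro h a b ⟨w⟩
    induction w with
    | nil => exact r.refl _
    | cons hab _ ih => exact r.trans (h _ _ hab) ih

lemma Setoid.reachableSetoid_toSimpleGraph {V : Type*} (r : Setoid V) :
    r.toSimpleGraph.reachableSetoid = r := by
  refine le_antisymm ((SimpleGraph.reachableSetoid_le_iff _ _).2 fun a b h => h.2) ?_
  intro a b h
  by_cases hab : a = b
  · exact hab ▸ SimpleGraph.Reachable.refl _
  · exact SimpleGraph.Adj.reachable (G := r.toSimpleGraph) ⟨hab, h⟩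

lemma SimpleGraph.reachableSetoid_sup {V : Type*} (G H : SimpleGraph V) :
    (G ⊔ H).reachableSetoid = G.reachableSetoid ⊔ H.reachableSetoid := by
  refine le_antisymm ((reachableSetoid_le_iff _ _).2 ?_) (sup_le ?_ ?_)
  · rintro a b (h | h)
    · exact (le_sup_left : G.reachableSetoid ≤ G.reachableSetoid ⊔ H.reachableSetoid) h.reachable
    · exact (le_sup_right : H.reachableSetoid ≤ G.reachableSetoid ⊔ H.reachableSetoid) h.reachable
  · exact (reachableSetoid_le_iff _ _).2 fun a b h => Adj.reachable (Or.inl h)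
  · exact (reachableSetoid_le_iff _ _).2 fun a b h => Adj.reachable (Or.inr h)

lemma connectedProblem_iff {n : ℕ} (EA EB : SimpleGraph (Fin n)) :
    ConnectedProblem n EA EB ↔ 0 < n ∧ EA.reachableSetoid ⊔ EB.reachableSetoid = ⊤ := by
  rw [ConnectedProblem, SimpleGraph.connected_iff, ← SimpleGraph.reachableSetoid_sup, and_comm]
  refine and_congr ?_ ?_
  · rw [← Fin.pos_iff_nonempty]
  · rw [eq_top_iff]
    exact ⟨fun h a b _ => h a b, fun h a b => h trivial⟩

/-- A deterministic protocol for connectivity has at least as many leaves as there are partitions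
of the vertex set. -/
lemma card_setoid_le_two_pow_cost {n : ℕ}
    (P : DetProtocol (SimpleGraph (Fin n)) (SimpleGraph (Fin n)))
    (hP : ∀ x y, P.output x y = true ↔ ConnectedProblem n x y) :
    Fintype.card (Setoid (Fin n)) ≤ 2 ^ P.cost := by
  classical
  rcases Nat.eq_zero_or_pos n with rfl | hn
  · have : Subsingleton (Setoid (Fin 0)) := ⟨fun r s => Setoid.ext fun a => a.elim0⟩
    exact Fintype.card_le_one_iff_subsingleton.2 this |>.trans Nat.one_le_two_pow
  have : Nonempty (Fin n) := Fin.pos_iff_nonempty.1 hn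
  obtain ⟨T, _, u, v, hT, e⟩ := P.exists_output_eq_sum
  refine le_trans ?_ hT
  let A : Matrix T (Setoid (Fin n)) ℚ := fun t r => u r.toSimpleGraph t
  -- The nonsingular matrix factors through `T`, so a vector killed by the factor `A` is killed by
  -- the whole matrix.
  have hinj : Function.Injective A.mulVecLin := by
    rw [← LinearMap.ker_eq_bot, LinearMap.ker_eq_bot']
    intro c h
    refine eq_zero_of_sum_sup_eq_top c fun s => ?_
    have he : ∀ r : Setoid (Fin n), (if r ⊔ s = ⊤ then (1 : ℚ) else 0) =
        ∑ t, u r.toSimpleGraph t * v t s.toSimpleGraph := by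
      intro r
      rw [← e]
      refine if_congr ?_ rfl rfl
      rw [hP, connectedProblem_iff, Setoid.reachableSetoid_toSimpleGraph,
        Setoid.reachableSetoid_toSimpleGraph]
      exact (and_iff_right hn).symm
    simp only [he, Finset.mul_sum]
    rw [Finset.sum_comm]
    refine Finset.sum_eq_zero fun t _ => ?_
    have h1 : ∑ r, u (Setoid.toSimpleGraph r) t * c r = 0 := congr_fun h t
    calc _ = (∑ r, u (Setoid.toSimpleGraph r) t * c r) * v t s.toSimpleGraph := by
          rw [Finset.sum_mul]
          exact Finset.sum_congr rfl fun r _ => by ring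
      _ = 0 := by rw [h1, zero_mul]
  have := LinearMap.finrank_le_finrank_of_injective hinj
  simpa using this

end ConnectedRank

/-! ### One-way protocols from encodings. -/

section Simulation

variable {X Y : Type}

/-- The extra bit is Bob's announcement of the answer, as a leaf label depends only on the
transcript. -/
lemma DetProtocol.exists_of_forall_encoding (L : ℕ) (enc : X → Qubits L)
    (g : Y → Qubits L → Bool) :
    ∃ P : DetProtocol X Y, P.cost = L + 1 ∧ ∀ x y, P.output x y = g y (enc x) := by
  induction L with
  | zero =>
    refine ⟨bobSends (fun y => g y Fin.elim0) leaf, by simp [cost], fun x y => ?_⟩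
    simp only [output]
    exact congr_arg (g y) (Subsingleton.elim _ _)
  | succ L ih =>
    choose P hc hP using fun b => ih (fun x => Fin.tail (enc x)) (fun y z => g y (Fin.cons b z))
    refine ⟨aliceSends (fun x => enc x 0) P, by simp only [cost, hc, max_self]; omega,
      fun x y => ?_⟩
    rw [output, hP, Fin.cons_self_tail]

/-- The unitary that permutes the computational basis. -/
noncomputable def permUnitary {p : ℕ} (σ : Equiv.Perm (Qubits p)) :
    Matrix.unitaryGroup (Qubits p) ℂ :=
  ⟨Matrix.of fun a a' => if a = σ a' then 1 else 0, by
    rw [Matrix.mem_unitaryGroup_iff']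
    ext a b
    simp only [Matrix.star_eq_conjTranspose, Matrix.mul_apply, Matrix.conjTranspose_apply,
      Matrix.one_apply, Matrix.of_apply]
    simp [apply_ite (starRingEnd ℂ), eq_comm]⟩

/-- The computational basis state `|a⟩ ⊗ |b⟩`. -/
noncomputable def basisState {p q : ℕ} (a : Qubits p) (b : Qubits q) : JointState p q :=
  fun a' b' => if a' = a ∧ b' = b then 1 else 0

lemma actAlice_basisState {p q : ℕ} (σ : Equiv.Perm (Qubits p)) (a : Qubits p) (b : Qubits q) :
    (basisState a b).actAlice (permUnitary σ) = basisState (σ a) b := by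
  ext a' b'
  by_cases hb : b' = b <;> simp [JointState.actAlice, permUnitary, basisState, hb]

lemma actBob_basisState {p q : ℕ} (σ : Equiv.Perm (Qubits q)) (a : Qubits p) (b : Qubits q) :
    (basisState a b).actBob (permUnitary σ) = basisState a (σ b) := by
  ext a' b'
  by_cases ha : a' = a <;> simp [JointState.actBob, permUnitary, basisState, ha]

lemma moveToBob_basisState {p q : ℕ} (a : Qubits (p + 1)) (b : Qubits q) :
    (basisState a b).moveToBob = basisState (Fin.tail a) (Fin.cons (a 0) b) := by
  ext a' b'
  simp only [JointState.moveToBob, basisState]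
  congr 1
  conv_lhs => rw [← Fin.cons_self_tail a, Fin.cons_inj]
  conv_rhs => rw [← Fin.cons_self_tail b', Fin.cons_inj]
  rw [eq_iff_iff]
  tauto

lemma probBobOne_basisState {p q : ℕ} (a : Qubits p) (b : Qubits (q + 1)) :
    (basisState a b).probBobOne = if b 0 = true then 1 else 0 := by
  have h : ∀ a' b', (if b' 0 = true then ‖basisState a b a' b'‖ ^ 2 else 0) =
      if a' = a then (if b' = b then (if b 0 = true then (1 : ℝ) else 0) else 0) else 0 := by
    intro a' b'
    by_cases h1 : a' = a <;> by_cases h2 : b' = b <;> simp [basisState, h1, h2]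
  simp only [JointState.probBobOne, h]
  simp

/-- The reversible computation of `g` from the qubits but the last into the last qubit, which
becomes the first. -/
def xorPerm {q : ℕ} (g : Qubits q → Bool) : Equiv.Perm (Qubits (q + 1)) where
  toFun w := Fin.cons (xor (w (Fin.last q)) (g (Fin.init w))) (Fin.init w)
  invFun w := Fin.snoc (α := fun _ => Bool) (Fin.tail w) (xor (w 0) (g (Fin.tail w)))
  left_inv w := by simp [Fin.tail_cons]
  right_inv w := by simp [Fin.init_snoc]

/-- On basis states the run is classical. Arriving qubits are stacked in front of Bob's blank last
qubit, which receives the answer at the end; `g` absorbs the reversed order. -/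
lemma QuantumProtocol.exists_alice_sends_all (p : ℕ) : ∀ (q : ℕ)
    (g : Y → Qubits p → Qubits q → Bool), ∃ P : QuantumProtocol X Y p (q + 1), P.cost = p ∧
      ∀ x y a b, P.probOne x y (basisState a (Fin.snoc (α := fun _ => Bool) b false)) =
        if g y a b = true then 1 else 0 := by
  induction p with
  | zero =>
    intro q g
    refine ⟨bobOutputs fun y => permUnitary (xorPerm (g y Fin.elim0)), rfl, fun x y a b => ?_⟩
    rw [probOne, actBob_basisState, probBobOne_basisState, Subsingleton.elim a Fin.elim0]
    simp [xorPerm]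
  | succ p ih =>
    intro q g
    obtain ⟨P, hc, hP⟩ := ih (q + 1) fun y a b => g y (Fin.cons (b 0) a) (Fin.tail b)
    refine ⟨aliceSends (fun _ => permUnitary 1) P, by rw [cost, hc], fun x y a b => ?_⟩
    rw [probOne, actAlice_basisState, moveToBob_basisState, Equiv.Perm.one_apply,
      Fin.cons_snoc_eq_snoc_cons, hP]
    simp

lemma QuantumProtocol.exists_of_forall_encoding (p : ℕ) (enc : X → Qubits p)
    (g : Y → Qubits p → Bool) : ∃ P : QuantumProtocol X Y p 1, P.cost = p ∧
      ∀ x y, P.probOne x y (JointState.zeroState p 1) = if g y (enc x) = true then 1 else 0 := by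
  have hz : JointState.zeroState p 1 = basisState (fun _ => false)
      (Fin.snoc (α := fun _ => Bool) (Fin.elim0 : Qubits 0) false) := by
    unfold JointState.zeroState basisState
    have : (fun _ : Fin 1 => false) =
        Fin.snoc (α := fun _ => Bool) (Fin.elim0 : Qubits 0) false := by
      funext i
      rw [Subsingleton.elim i (Fin.last 0), Fin.snoc_last]
    rw [← this]
  cases p with
  | zero =>
    obtain ⟨P, hc, hP⟩ := exists_alice_sends_all (X := X) 0 0 fun y a (_ : Qubits 0) => g y a
    refine ⟨P, hc, fun x y => ?_⟩
    rw [hz, hP, Subsingleton.elim (enc x) (fun _ => false)]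
  | succ p =>
    obtain ⟨P, hc, hP⟩ := exists_alice_sends_all (X := X) p 1
      fun y a (b : Qubits 1) => g y (Fin.cons (b 0) a)
    -- Alice writes her message by exchanging `|0…0⟩` with `|enc x⟩` before the first qubit leaves.
    refine ⟨aliceSends (fun x => permUnitary (Equiv.swap (fun _ => false) (enc x))) P,
      by rw [cost, hc], fun x y => ?_⟩
    rw [hz, probOne, actAlice_basisState, moveToBob_basisState, Equiv.swap_apply_left,
      Fin.cons_snoc_eq_snoc_cons, hP]
    simp

end Simulation

/-! ### Comparison of `Q₂` with `D`, and the upper bound on `D`. -/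

section UpperBounds

open Classical in
/-- Connectivity as a function of Bob's input and of an encoding of the components of Alice's. -/
lemma exists_encoding_connectedProblem {n L : ℕ} (h : Fintype.card (Setoid (Fin n)) ≤ 2 ^ L) :
    ∃ (enc : SimpleGraph (Fin n) → Qubits L) (g : SimpleGraph (Fin n) → Qubits L → Bool),
      ∀ x y, g y (enc x) = true ↔ ConnectedProblem n x y := by
  obtain ⟨ι⟩ : Nonempty (Setoid (Fin n) ↪ Qubits L) :=
    Function.Embedding.nonempty_of_card_le (by simpa using h)
  refine ⟨fun x => ι x.reachableSetoid,
    fun y z => decide (0 < n ∧ ∃ r, ι r = z ∧ r ⊔ y.reachableSetoid = ⊤), fun x y => ?_⟩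
  simp [connectedProblem_iff]

/-- The tree is not simulated: its cost `c` bounds the number of partitions by `2 ^ c`, so `c`
qubits suffice to name Alice's, and Bob outputs the answer for free. -/
lemma quantumCC_connectedProblem_le_detCC (n : ℕ) :
    quantumCC noPromise (ConnectedProblem n) ≤ detCC (ConnectedProblem n) := by
  refine le_iInf₂ fun P hP => ?_
  obtain ⟨enc, g, hg⟩ := exists_encoding_connectedProblem (card_setoid_le_two_pow_cost P hP)
  obtain ⟨Q, hc, hQ⟩ := QuantumProtocol.exists_of_forall_encoding P.cost enc g
  refine iInf_le_of_le P.cost (iInf_le_of_le 1 (iInf_le_of_le Q (iInf_le_of_le ?_ (by rw [hc]))))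
  intro x y _
  rw [hQ, ← hg]
  split_ifs with h <;> norm_num [h]

lemma detCC_connectedProblem_le {n L : ℕ} (h : Fintype.card (Setoid (Fin n)) ≤ 2 ^ L) :
    detCC (ConnectedProblem n) ≤ (L + 1 : ℕ) := by
  obtain ⟨enc, g, hg⟩ := exists_encoding_connectedProblem h
  obtain ⟨P, hc, hP⟩ := DetProtocol.exists_of_forall_encoding L enc g
  exact iInf₂_le_of_le P (fun x y => by rw [hP, hg]) (by rw [hc])

/-- A partition is determined by the map that sends each point to a chosen representative of its
class. -/
lemma card_setoid_fin_le (n : ℕ) : Fintype.card (Setoid (Fin n)) ≤ n ^ n := by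
  rcases Nat.eq_zero_or_pos n with rfl | hn
  · exact Fintype.card_le_one_iff_subsingleton.2 ⟨fun r s => Setoid.ext fun a => a.elim0⟩
  have hinj : Function.Injective fun (r : Setoid (Fin n)) (a : Fin n) =>
      (Quotient.mk r a).out := by
    intro r s h
    ext a b
    have e : ∀ t : Setoid (Fin n), t a b ↔ (Quotient.mk t a).out = (Quotient.mk t b).out :=
      fun t => by rw [Quotient.out_inj]; exact Quotient.eq.symm
    rw [e r, e s]
    have ha := congr_fun h a
    have hb := congr_fun h b
    simp only at ha hb
    rw [ha, hb]
  simpa using Fintype.card_le_of_injective _ hinj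

lemma exists_detCC_connectedProblem_le :
    ∃ C : ℝ, 0 < C ∧ ∀ᶠ n : ℕ in atTop,
      (detCC (ConnectedProblem n) : ℝ≥0∞) ≤ ENNReal.ofReal (C * (n * Real.log n)) := by
  -- For `n ≥ 3` one has `log n ≥ 1` and `clog 2 n ≤ 2 log n + 1`, so `n * clog 2 n + 1 ≤ 4 n log
  -- n`; 5 leaves room.
  refine ⟨5, by norm_num, ?_⟩
  filter_upwards [eventually_ge_atTop 3] with n hn
  have hc : Fintype.card (Setoid (Fin n)) ≤ 2 ^ (n * Nat.clog 2 n) := by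
    refine (card_setoid_fin_le n).trans ?_
    rw [mul_comm, pow_mul]
    exact Nat.pow_le_pow_left (Nat.le_pow_clog one_lt_two n) n
  have h1 : (detCC (ConnectedProblem n) : ℝ≥0∞) ≤ ((n * Nat.clog 2 n + 1 : ℕ) : ℝ≥0∞) := by
    exact_mod_cast ENat.toENNReal_le.2 (detCC_connectedProblem_le hc)
  refine h1.trans ?_
  rw [← ENNReal.ofReal_natCast]
  refine ENNReal.ofReal_le_ofReal ?_
  have hn3 : (3 : ℝ) ≤ n := by exact_mod_cast hn
  have hlog : 1 ≤ Real.log n := by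
    rw [Real.le_log_iff_exp_le (by linarith)]
    exact Real.exp_one_lt_d9.le.trans (by linarith)
  have hlog2 : (Nat.clog 2 n : ℝ) ≤ Real.logb 2 n + 1 := by
    have := Real.natCeil_logb_natCast 2 n
    rw [← this]
    exact (Nat.ceil_lt_add_one (Real.logb_nonneg one_lt_two (by linarith))).le
  have hb : Real.logb 2 n ≤ 2 * Real.log n := by
    rw [Real.logb, div_le_iff₀ (Real.log_pos one_lt_two)]
    nlinarith [Real.log_two_gt_d9]
  push_cast
  nlinarith

end UpperBounds

/-! ### The linear lower bound. -/

section LowerBound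

/-- The infinite bit string that continues `x` by zeros. -/
def extendBits {N : ℕ} (x : Fin N → Bool) (i : ℕ) : Bool := if h : i < N then x ⟨i, h⟩ else false

lemma innerSign_eq_one_iff {N : ℕ} (x y : Fin N → Bool) :
    innerSign x y = 1 ↔ innerParity (extendBits x) (extendBits y) N = false := by
  have h : ∀ (u v : ℕ → Bool) (i : ℕ), (if innerParity u v i = true then (-1 : ℝ) else 1) =
      ∏ j ∈ Finset.range i, if (u j && v j) = true then -1 else 1 := by
    intro u v i
    induction i with
    | zero => simp [innerParity]
    | succ i ih =>
      rw [Finset.prod_range_succ, ← ih, innerParity]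
      cases innerParity u v i <;> cases u i <;> cases v i <;> simp
  have e : innerSign x y = ∏ j ∈ Finset.range N,
      if (extendBits x j && extendBits y j) = true then (-1 : ℝ) else 1 := by
    rw [Finset.prod_range, innerSign]
    simp [extendBits]
  rw [e, ← h]
  cases innerParity (extendBits x) (extendBits y) N <;> norm_num

lemma cost_ge_of_computes_connectedProblem {n p q : ℕ} (hn : 260 ≤ n)
    (P : QuantumProtocol (SimpleGraph (Fin n)) (SimpleGraph (Fin n)) p q) (ψ : JointState p q)
    (hψ : ψ.normSq = 1) (hP : P.Computes ψ (disjointSparse 1 n) (ConnectedProblem n)) :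
    n / 128 ≤ P.cost := by
  -- The largest `N` for which the closing vertex `16 * N + 2` exists.
  obtain ⟨N, hN⟩ : ∃ N, N = (n - 3) / 16 := ⟨_, rfl⟩
  have := P.cost_ge_of_computes_innerSign (N := N) ψ hψ hP
    (fun x => aliceGraph n N (extendBits x)) (fun y => bobGraph n N (extendBits y))
    (fun x y => ⟨disjoint_aliceGraph_bobGraph, by
      rw [aliceGraph_sup_bobGraph, one_mul]
      exact parentGraph_edgeSet_ncard_le _ _⟩)
    (fun x y => (connected_gadget_iff (by omega) (by omega)).trans (innerSign_eq_one_iff x y).symm)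
  omega

lemma exists_le_entangledQuantumCC_disjointSparse :
    ∃ c : ℝ, 0 < c ∧ ∃ K : ℕ, ∀ᶠ n : ℕ in atTop,
      ENNReal.ofReal (c * n) ≤
        (entangledQuantumCC (disjointSparse K n) (ConnectedProblem n) : ℝ≥0∞) := by
  -- The rounding in `n / 128` loses at most a factor of 2 once `n ≥ 128`.
  refine ⟨1 / 256, by norm_num, 1, ?_⟩
  filter_upwards [eventually_ge_atTop 260] with n hn
  have h1 : ((n / 128 : ℕ) : ℕ∞) ≤
      entangledQuantumCC (disjointSparse 1 n) (ConnectedProblem n) := by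
    refine le_iInf fun p => le_iInf fun q => le_iInf fun ψ => le_iInf fun hψ => le_iInf fun P =>
      le_iInf fun hP => ?_
    exact_mod_cast cost_ge_of_computes_connectedProblem hn P ψ hψ hP
  have h2 : (((n / 128 : ℕ) : ℕ) : ℝ≥0∞) ≤
      (entangledQuantumCC (disjointSparse 1 n) (ConnectedProblem n) : ℝ≥0∞) := by
    exact_mod_cast ENat.toENNReal_le.2 h1
  refine le_trans ?_ h2
  rw [← ENNReal.ofReal_natCast]
  refine ENNReal.ofReal_le_ofReal ?_
  have h3 : n ≤ 256 * (n / 128) := by omega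
  have h4 : (n : ℝ) ≤ 256 * ((n / 128 : ℕ) : ℝ) := by exact_mod_cast h3
  linarith

lemma entangledQuantumCC_le_noPromise {X Y : Type} (S f : X → Y → Prop) :
    entangledQuantumCC S f ≤ entangledQuantumCC noPromise f := by
  refine le_iInf fun p => le_iInf fun q => le_iInf fun ψ => le_iInf fun hψ => le_iInf fun P =>
    le_iInf fun hP => ?_
  exact iInf_le_of_le p (iInf_le_of_le q (iInf_le_of_le ψ (iInf_le_of_le hψ (iInf_le_of_le P
    (iInf_le _ fun x y _ => hP x y trivial)))))

lemma normSq_zeroState (p q : ℕ) : (JointState.zeroState p q).normSq = 1 := by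
  have h : ∀ a b, ‖JointState.zeroState p q a b‖ ^ 2 =
      if a = (fun _ => false) then (if b = (fun _ => false) then (1 : ℝ) else 0) else 0 := by
    intro a b
    by_cases h1 : a = (fun _ => false) <;> by_cases h2 : b = (fun _ => false) <;>
      simp [JointState.zeroState, h1, h2]
  simp only [JointState.normSq, h]
  simp

lemma entangledQuantumCC_le_quantumCC {X Y : Type} (S f : X → Y → Prop) :
    entangledQuantumCC S f ≤ quantumCC S f := by
  refine le_iInf fun p => le_iInf fun q => le_iInf fun P => le_iInf fun hP => ?_
  exact iInf_le_of_le p (iInf_le_of_le q (iInf_le_of_le (JointState.zeroState p q)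
    (iInf_le_of_le (normSq_zeroState p q) (iInf_le_of_le P (iInf_le _ hP)))))

end LowerBound

theorem mainTheorem1 :
    -- `Ω(n) ≤ Q₂(Connected_n)`
    (∃ c : ℝ, 0 < c ∧ ∀ᶠ n : ℕ in atTop,
      ENNReal.ofReal (c * n) ≤ (quantumCC noPromise (ConnectedProblem n) : ℝ≥0∞)) ∧
    -- `Q₂(Connected_n) ≤ D(Connected_n)`
    (∀ n : ℕ, quantumCC noPromise (ConnectedProblem n) ≤ detCC (ConnectedProblem n)) ∧
    -- `D(Connected_n) ≤ O(n log n)`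
    (∃ C : ℝ, 0 < C ∧ ∀ᶠ n : ℕ in atTop,
      (detCC (ConnectedProblem n) : ℝ≥0∞) ≤ ENNReal.ofReal (C * (n * Real.log n))) ∧
    -- the lower bound holds with unlimited prior entanglement
    (∃ c : ℝ, 0 < c ∧ ∀ᶠ n : ℕ in atTop,
      ENNReal.ofReal (c * n) ≤ (entangledQuantumCC noPromise (ConnectedProblem n) : ℝ≥0∞)) ∧
    -- and even then for disjoint edge sets with `O(n)` edges in total
    (∃ c : ℝ, 0 < c ∧ ∃ K : ℕ, ∀ᶠ n : ℕ in atTop,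
      ENNReal.ofReal (c * n) ≤
        (entangledQuantumCC (disjointSparse K n) (ConnectedProblem n) : ℝ≥0∞)) := by
  obtain ⟨c, hc, K, hK⟩ := exists_le_entangledQuantumCC_disjointSparse
  have hE : ∀ᶠ n : ℕ in atTop, ENNReal.ofReal (c * n) ≤
      (entangledQuantumCC noPromise (ConnectedProblem n) : ℝ≥0∞) :=
    hK.mono fun n hn => hn.trans (ENat.toENNReal_le.2 (entangledQuantumCC_le_noPromise _ _))
  exact ⟨⟨c, hc, hE.mono fun n hn =>
      hn.trans (ENat.toENNReal_le.2 (entangledQuantumCC_le_quantumCC _ _))⟩,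
    quantumCC_connectedProblem_le_detCC, exists_detCC_connectedProblem_le, ⟨c, hc, hE⟩,
    ⟨c, hc, K, hK⟩⟩
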